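/- Let $\mathbb K=\mathbb C$ or $\mathbb K=\mathbb R$, and let $F(x,y)$ be a nonzero binary form (homogeneous polynomial) of degree $n$ with coefficients in $\mathbb K$. Let $G_F=\{A\in GL(2,\mathbb K): F(A\mathbf x)=F(\mathbf x)\}$ be its symmetry group, let $\Gamma_F$ be the image of $G_F$ in $GL(2,\mathbb K)/\{\lambda I\}$ (the projective symmetry group), and call $k=\#\Gamma_F$ the projective index of $F$. Put $$H=F_{xx}F_{yy}-F_{xy}^2,\qquad T=F_xH_y-F_yH_x,\qquad U=F_xT_y-F_yT_x .$$ Suppose that $F$ is not complex-equivalent to a monomial, i.e. there is no $A\in GL(2,\mathbb C)$ such that $F(A\mathbf x)=c\,x^iy^j$ for some $c\in\mathbb C$ and $i,j\ge 0$. Then $G_F$ is finite (so that $k$ is finite), and $$k\le\begin{cases}6n-12 & \text{if } U=cH^2 \text{ for some constant } c\in\mathbb K,\\ 4n-8 & \text{in all other cases.}\end{cases}$$ -/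

import Mathlib

open scoped MatrixGroups

noncomputable section

namespace BinaryForm

open MvPolynomial

/-- The form `F(A x)`, obtained from `F` by the linear change of variables `x ↦ A x`; here
`x = X 0` and `y = X 1` are the two variables. -/
def subst {K : Type*} [CommRing K] (A : Matrix (Fin 2) (Fin 2) K) (F : MvPolynomial (Fin 2) K) :
    MvPolynomial (Fin 2) K :=
  aeval (fun i => ∑ j, C (A i j) * X j) F

theorem subst_one {K : Type*} [CommRing K] (F : MvPolynomial (Fin 2) K) : subst 1 F = F := by
  have h : (fun i : Fin 2 => ∑ j, C ((1 : Matrix (Fin 2) (Fin 2) K) i j) * X j)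
      = (X : Fin 2 → MvPolynomial (Fin 2) K) := by
    funext i
    simp [Matrix.one_apply]
  rw [subst, h, aeval_X_left_apply]

theorem subst_mul {K : Type*} [CommRing K] (A B : Matrix (Fin 2) (Fin 2) K)
    (F : MvPolynomial (Fin 2) K) : subst (A * B) F = subst B (subst A F) := by
  have h : aeval (fun i : Fin 2 => ∑ j, C ((A * B) i j) * X j)
      = (aeval (fun i : Fin 2 => ∑ j, C (B i j) * X j)).comp
          (aeval (fun i : Fin 2 => ∑ j, C (A i j) * (X j : MvPolynomial (Fin 2) K))) := by
    apply algHom_ext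
    intro i
    simp [Matrix.mul_apply, Fin.sum_univ_two, algHom_C]
    ring
  exact congrArg (fun φ => φ F) h

/-- Two forms are equivalent if one is obtained from the other by an invertible linear change of
variables: `G(x) = F(A x)`. -/
def Equivalent {K : Type*} [CommRing K] (F G : MvPolynomial (Fin 2) K) : Prop :=
  ∃ A : GL (Fin 2) K, G = subst (A : Matrix (Fin 2) (Fin 2) K) F

/-- `F` is equivalent to a monomial `c x ^ i y ^ j`. -/
def EquivalentToMonomial {K : Type*} [CommRing K] (F : MvPolynomial (Fin 2) K) : Prop :=
  ∃ (c : K) (i j : ℕ), Equivalent F (C c * X 0 ^ i * X 1 ^ j)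

/-- The symmetry group `G_F`: all `A ∈ GL(2, K)` with `F(A x) = F(x)`. -/
def symmetryGroup {K : Type*} [CommRing K] (F : MvPolynomial (Fin 2) K) :
    Subgroup (GL (Fin 2) K) where
  carrier := {A | subst (A : Matrix (Fin 2) (Fin 2) K) F = F}
  one_mem' := by
    simp [subst_one]
  mul_mem' := by
    intro A B hA hB
    simp only [Set.mem_ofPred_eq] at hA hB ⊢
    rw [Units.val_mul, subst_mul, hA, hB]
  inv_mem' := by
    intro A hA
    simp only [Set.mem_ofPred_eq] at hA ⊢
    conv_lhs => rw [← hA]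
    rw [← subst_mul, ← Units.val_mul, mul_inv_cancel, Units.val_one, subst_one]

/-- The projective symmetry group `Γ_F`: the image of `G_F` in `PGL(2, K) = GL(2, K) / {λ I}`. -/
def projSymmetryGroup {K : Type*} [CommRing K] (F : MvPolynomial (Fin 2) K) :
    Subgroup PGL(2, K) :=
  (symmetryGroup F).map Matrix.ProjGenLinGroup.mk

/-- A form is nonsingular if its symmetry group is finite. -/
def Nonsingular {K : Type*} [CommRing K] (F : MvPolynomial (Fin 2) K) : Prop :=
  Finite (symmetryGroup F)

/-- The projective index of a nonsingular form: the number of its projective symmetries. -/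
def projIndex {K : Type*} [CommRing K] (F : MvPolynomial (Fin 2) K) : ℕ :=
  Nat.card (projSymmetryGroup F)

/-- `F_x G_y - F_y G_x`. -/
def jacobian {K : Type*} [CommRing K] (F G : MvPolynomial (Fin 2) K) : MvPolynomial (Fin 2) K :=
  pderiv 0 F * pderiv 1 G - pderiv 1 F * pderiv 0 G

/-- The Hessian `H = F_xx F_yy - F_xy ^ 2`. -/
def covH {K : Type*} [CommRing K] (F : MvPolynomial (Fin 2) K) : MvPolynomial (Fin 2) K :=
  pderiv 0 (pderiv 0 F) * pderiv 1 (pderiv 1 F) - (pderiv 0 (pderiv 1 F)) ^ 2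

/-- The covariant `T = F_x H_y - F_y H_x`. -/
def covT {K : Type*} [CommRing K] (F : MvPolynomial (Fin 2) K) : MvPolynomial (Fin 2) K :=
  jacobian F (covH F)

/-- The covariant `U = F_x T_y - F_y T_x`. -/
def covU {K : Type*} [CommRing K] (F : MvPolynomial (Fin 2) K) : MvPolynomial (Fin 2) K :=
  jacobian F (covT F)

/-- `U = c H ^ 2` for some constant `c`. -/
def MaximalDiscreteClass {K : Type*} [CommRing K] (F : MvPolynomial (Fin 2) K) : Prop :=
  ∃ c : K, covU F = C c * covH F ^ 2

end BinaryForm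

end

/-! A nonconstant quotient `S / R` of binary forms of degree `d` that is invariant under `G_F`
bounds `#Γ_F` by `d`. A general point of the projective line has pairwise distinct images under any
finite set of elements of `Γ_F`, and they all lie in one fibre of `S / R`, the zero set of a nonzero
form of degree `d` (`card_projSymmetry_le`). By the chain rule, `H`, `T`, `U` are multiplied by
powers 2, 3, 4 of one scalar under a symmetry. Hence `T² / H³`, of degree `6(n - 2)`, and `U / H²`,
of degree `4(n - 2)`, are invariant. The second is nonconstant unless `U = cH²`.

What remains is that `H ≠ 0` and `T² / H³` is nonconstant unless `F` is complex-equivalent to a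
monomial (`covT_sq_ne`). Over an algebraically closed field, move coordinates so that `f(t) = F(t,
1)` has degree `n`. A root of `f` of multiplicity `m < n` is a zero of `H` of order exactly `2m -
2`. If `T² = cH³`, comparing orders of vanishing shows that `H` vanishes only at zeros of `F`, and
not at infinity. So `2(n - 2) = ∑ (2m - 2) = 2n - 2r` for the `r` distinct roots; thus `r ≤ 2`, and
`F` is equivalent to a monomial. -/

noncomputable section

namespace BinaryForm

/-! ### Orders of vanishing of the Hessian and of the Jacobian -/

section LocalAnalysis

open Polynomial

/-- Up to the factor `n - 1`, the Hessian of a form of degree `n`, in terms of `f(t) = F(t, 1)`. -/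
def uniHessian {K : Type*} [CommRing K] (n : ℕ) (f : K[X]) : K[X] :=
  n * f * f.derivative.derivative - (n - 1) * f.derivative ^ 2

variable {K : Type*} [Field K]

/-- With `M = m + 1`, the lowest coefficient at `a` is `nM(M - 1) - (n - 1)M² = M(M - n)` times
`g(a)²`. It is nonzero in characteristic zero when `0 < M < n`. -/
theorem uniHessian_X_sub_C_pow_mul (n m : ℕ) (a : K) (g : K[X]) :
    ∃ q : K[X], uniHessian n ((X - C a) ^ (m + 1) * g) = (X - C a) ^ (2 * m) * q ∧
      q.eval a = (m + 1) * ((m + 1) - n) * g.eval a ^ 2 := by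
  set t : K[X] := X - C a with ht
  have ht' : t.derivative = 1 := by simp [ht]
  refine ⟨n * g * (m * ((m + 1) * g + t * g.derivative)
    + t * ((m + 1) * g + t * g.derivative).derivative)
    - (n - 1) * ((m + 1) * g + t * g.derivative) ^ 2, ?_, ?_⟩
  · have h1 : (t ^ (m + 1) * g).derivative = t ^ m * ((m + 1) * g + t * g.derivative) := by
      simp only [derivative_mul, derivative_pow, ht', Nat.cast_add, Nat.cast_one,
        Nat.add_sub_cancel, map_add, map_natCast, map_one]
      ring
    have h2 : t * (t ^ m * ((m + 1) * g + t * g.derivative)).derivative =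
        t ^ m * (m * ((m + 1) * g + t * g.derivative)
          + t * ((m + 1) * g + t * g.derivative).derivative) := by
      rw [derivative_mul, derivative_pow, ht']
      rcases m with _ | m
      · simp
      · simp only [Nat.add_sub_cancel, map_natCast]
        ring
    rw [uniHessian, h1]
    linear_combination (n * t ^ m * g) * h2
  · simp [ht]
    ring

theorem rootMultiplicity_eq_of_eq_mul {p q : K[X]} {a : K} {k : ℕ} (h : p = (X - C a) ^ k * q)
    (hq : q.eval a ≠ 0) : p ≠ 0 ∧ p.rootMultiplicity a = k := by
  have hq0 : q ≠ 0 := by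
    rintro rfl
    simp at hq
  have hp : p ≠ 0 := by
    rw [h]
    exact mul_ne_zero (pow_ne_zero _ (X_sub_C_ne_zero a)) hq0
  refine ⟨hp, ?_⟩
  rw [h, rootMultiplicity_mul (h ▸ hp), rootMultiplicity_X_sub_C_pow,
    rootMultiplicity_eq_zero hq, add_zero]

variable [CharZero K]

theorem rootMultiplicity_uniHessian {n : ℕ} {f : K[X]} (hf : f ≠ 0) {a : K}
    (h0 : 0 < f.rootMultiplicity a) (hn : f.rootMultiplicity a < n) :
    uniHessian n f ≠ 0 ∧
      (uniHessian n f).rootMultiplicity a + 2 = 2 * f.rootMultiplicity a := by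
  obtain ⟨g, hg, hga⟩ := exists_eq_pow_rootMultiplicity_mul_and_not_dvd f hf a
  obtain ⟨m, hm⟩ : ∃ m, f.rootMultiplicity a = m + 1 := ⟨_, (Nat.succ_pred_eq_of_pos h0).symm⟩
  rw [hm] at hg hn ⊢
  obtain ⟨q, hq, hqa⟩ := uniHessian_X_sub_C_pow_mul n m a g
  rw [← hg] at hq
  have hne : q.eval a ≠ 0 := by
    rw [hqa]
    refine mul_ne_zero (mul_ne_zero (Nat.cast_add_one_ne_zero m) (sub_ne_zero.2 ?_))
      (pow_ne_zero _ fun h => hga (dvd_iff_isRoot.2 h))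
    exact_mod_cast hn.ne
  obtain ⟨h1, h2⟩ := rootMultiplicity_eq_of_eq_mul hq hne
  exact ⟨h1, by omega⟩

/-- A zero `a` of `h` at which `f` does not vanish is excluded by `j ^ 2 = c h ^ 3`, where `j` is
the Jacobian of the forms of degrees `n` and `k` given by `f` and `h`. -/
theorem eval_eq_zero_of_jacobian_sq {n k : ℕ} (hn : n ≠ 0) {f h : K[X]} {c : K} (h0 : h ≠ 0)
    (hj : (k * f.derivative * h - n * f * h.derivative) ^ 2 = C c * h ^ 3) {a : K}
    (ha : h.eval a = 0) : f.eval a = 0 := by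
  obtain ⟨w, hw, hwa⟩ := exists_eq_pow_rootMultiplicity_mul_and_not_dvd h h0 a
  have hpos : 0 < h.rootMultiplicity a := (rootMultiplicity_pos h0).2 ha
  obtain ⟨e, he⟩ : ∃ e, h.rootMultiplicity a = e + 1 := ⟨_, (Nat.succ_pred_eq_of_pos hpos).symm⟩
  rw [he] at hw
  set t : K[X] := X - C a with ht
  have ht' : t.derivative = 1 := by simp [ht]
  have hh : h.derivative = t ^ e * ((e + 1) * w + t * w.derivative) := by
    rw [hw]
    simp only [derivative_mul, derivative_pow, ht', Nat.cast_add, Nat.cast_one,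
      Nat.add_sub_cancel, map_add, map_natCast, map_one]
    ring
  -- Each side carries the factor `t ^ (2e)`. After cancelling it, at `a` the left side is `(n f(a)
  -- (e + 1) w(a))²`, while the right side still contains `t ^ (e + 3)`.
  have key : (t ^ e) ^ 2 * (k * f.derivative * t * w
      - n * f * ((e + 1) * w + t * w.derivative)) ^ 2
      = (t ^ e) ^ 2 * (C c * t ^ (e + 3) * w ^ 3) := by
    rw [hh] at hj
    calc _ = (k * f.derivative * (t ^ (e + 1) * w)
          - n * f * (t ^ e * ((e + 1) * w + t * w.derivative))) ^ 2 := by ring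
      _ = C c * (t ^ (e + 1) * w) ^ 3 := by rw [← hw, hj]
      _ = _ := by ring
  have key2 := congrArg (eval a)
    (mul_left_cancel₀ (pow_ne_zero 2 (pow_ne_zero e (X_sub_C_ne_zero a))) key)
  have hwa' : w.eval a ≠ 0 := fun h => hwa (dvd_iff_isRoot.2 h)
  have he' : (e : K) + 1 ≠ 0 := Nat.cast_add_one_ne_zero e
  simpa [ht, hn, hwa', he'] using key2

/-- The analogue at infinity: `j ^ 2 = c h ^ 3` excludes a zero of `h` there. -/
theorem le_natDegree_of_jacobian_sq {n : ℕ} (hn : 2 ≤ n) {f h : K[X]} {c : K} (h0 : h ≠ 0)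
    (hf : f.natDegree = n)
    (hj : (((2 * (n - 2) : ℕ) : K[X]) * f.derivative * h - n * f * h.derivative) ^ 2
      = C c * h ^ 3) : 2 * (n - 2) ≤ h.natDegree := by
  by_contra! hlt
  set k := 2 * (n - 2) with hk
  set e := h.natDegree with he
  set j := (k : K[X]) * f.derivative * h - n * f * h.derivative with hjdef
  have hf0 : f ≠ 0 := by
    rintro rfl
    simp at hf
    omega
  -- The top coefficients of `j` do not cancel when `e < k`. The factor `X` keeps the index at `n +
  -- e` instead of `n + e - 1`.
  have hXj : (X * j).coeff (n + e) = n * (k - e) * (f.leadingCoeff * h.leadingCoeff) := by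
    have hd : ∀ p : K[X], ∀ d, p.natDegree = d → (X * p.derivative).natDegree ≤ d ∧
        (X * p.derivative).coeff d = d * p.leadingCoeff := by
      rintro p _ rfl
      constructor
      · rcases Nat.eq_zero_or_pos p.natDegree with h | h
        · rw [eq_C_of_natDegree_eq_zero h]
          simp
        · refine natDegree_mul_le.trans ?_
          have := natDegree_derivative_lt h.ne'
          rw [natDegree_X]
          omega
      · rcases hp : p.natDegree with _ | d
        · simp
        · rw [coeff_X_mul, coeff_derivative, leadingCoeff, hp]
          push_cast
          ring
    obtain ⟨hf1, hf2⟩ := hd f n hf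
    obtain ⟨hh1, hh2⟩ := hd h e rfl
    have h1 : X * j = C (k : K) * ((X * f.derivative) * h)
        - C (n : K) * (f * (X * h.derivative)) := by
      rw [hjdef, map_natCast, map_natCast]
      ring
    rw [h1, coeff_sub, coeff_C_mul, coeff_C_mul, coeff_mul_add_eq_of_natDegree_le hf1 he.ge,
      coeff_mul_add_eq_of_natDegree_le hf.le hh1, hf2, hh2]
    rw [leadingCoeff, leadingCoeff, hf, ← he]
    ring
  have hne : (X * j).coeff (n + e) ≠ 0 := by
    rw [hXj]
    refine mul_ne_zero (mul_ne_zero ?_ (sub_ne_zero.2 ?_)) (mul_ne_zero ?_ ?_)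
    · exact_mod_cast (by omega : n ≠ 0)
    · exact_mod_cast hlt.ne'
    · simpa using hf0
    · simpa using h0
  have hdeg := le_natDegree_of_ne_zero hne
  have hj0 : j ≠ 0 := by
    rintro h
    simp [h] at hne
  rw [natDegree_X_mul hj0] at hdeg
  have h1 := congrArg natDegree hj
  rw [natDegree_pow] at h1
  have h2 : (C c * h ^ 3).natDegree ≤ 3 * e := (natDegree_C_mul_le _ _).trans natDegree_pow_le
  -- Comparing degrees gives `2(n + e - 1) ≤ 3e`, so `e ≥ 2n - 2`, against `e < 2n - 4`.
  omega

/-- All roots of the Hessian `h` are roots of `f`, so summing `2m - 2` over the roots of `f` gives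
`deg h = 2n - 2r`, while `deg h ≥ 2n - 4`. -/
theorem card_roots_le_two_of_jacobian_sq [IsAlgClosed K] [DecidableEq K] {n : ℕ} (hn : 2 ≤ n)
    {f : K[X]} {c : K} (hf : f.natDegree = n) (hmult : ∀ a, f.rootMultiplicity a < n)
    (hj : (((2 * (n - 2) : ℕ) : K[X]) * f.derivative * uniHessian n f
      - n * f * (uniHessian n f).derivative) ^ 2 = C c * uniHessian n f ^ 3) :
    f.roots.toFinset.card ≤ 2 := by
  have hf0 : f ≠ 0 := by
    rintro rfl
    simp at hf
    omega
  obtain ⟨b, hb⟩ := IsAlgClosed.exists_root f (by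
    rw [degree_eq_natDegree hf0, hf]
    exact_mod_cast (by omega : n ≠ 0))
  set h := uniHessian n f
  have h0 : h ≠ 0 := (rootMultiplicity_uniHessian hf0 ((rootMultiplicity_pos hf0).2 hb) (hmult b)).1
  have hdeg := le_natDegree_of_jacobian_sq hn h0 hf hj
  have hsub : h.roots.toFinset ⊆ f.roots.toFinset := by
    intro a ha
    have ha' : h.eval a = 0 := by simpa [h0] using ha
    simpa [hf0] using eval_eq_zero_of_jacobian_sq (by omega) h0 hj ha'
  have hcard : ∀ p : K[X], p.roots.toFinset ⊆ f.roots.toFinset →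
      ∑ a ∈ f.roots.toFinset, p.rootMultiplicity a = p.natDegree := by
    intro p hp
    rw [← splits_iff_card_roots.1 (IsAlgClosed.splits p), ← Multiset.sum_count_eq_card
      (s := f.roots.toFinset) (fun a ha => hp (Multiset.mem_toFinset.2 ha))]
    exact Finset.sum_congr rfl fun a _ => (count_roots p).symm
  have hsum : ∑ a ∈ f.roots.toFinset, (h.rootMultiplicity a + 2)
      = ∑ a ∈ f.roots.toFinset, 2 * f.rootMultiplicity a := by
    refine Finset.sum_congr rfl fun a ha => ?_
    refine (rootMultiplicity_uniHessian hf0 ((rootMultiplicity_pos hf0).2 ?_) (hmult a)).2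
    simpa [hf0] using ha
  rw [Finset.sum_add_distrib, hcard h hsub, ← Finset.mul_sum, hcard f (Finset.Subset.refl _), hf,
    Finset.sum_const, smul_eq_mul] at hsum
  omega

end LocalAnalysis

open MvPolynomial

/-! ### Behaviour of the covariants under linear substitution -/

section Covariance

variable {K : Type*} [CommRing K]

theorem subst_add (A : Matrix (Fin 2) (Fin 2) K) (F G : MvPolynomial (Fin 2) K) :
    subst A (F + G) = subst A F + subst A G := map_add _ _ _

theorem subst_sub (A : Matrix (Fin 2) (Fin 2) K) (F G : MvPolynomial (Fin 2) K) :
    subst A (F - G) = subst A F - subst A G := map_sub _ _ _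

theorem subst_mul_form (A : Matrix (Fin 2) (Fin 2) K) (F G : MvPolynomial (Fin 2) K) :
    subst A (F * G) = subst A F * subst A G := map_mul _ _ _

theorem subst_pow (A : Matrix (Fin 2) (Fin 2) K) (F : MvPolynomial (Fin 2) K) (k : ℕ) :
    subst A (F ^ k) = subst A F ^ k := map_pow _ _ _

theorem subst_C (A : Matrix (Fin 2) (Fin 2) K) (c : K) : subst A (C c) = C c := by
  simp [subst]

theorem subst_X (A : Matrix (Fin 2) (Fin 2) K) (i : Fin 2) :
    subst A (X i) = C (A i 0) * X 0 + C (A i 1) * X 1 := by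
  simp [subst, Fin.sum_univ_two]

theorem eval_subst (A : Matrix (Fin 2) (Fin 2) K) (F : MvPolynomial (Fin 2) K) (p : Fin 2 → K) :
    eval p (subst A F) = eval (A.mulVec p) F := by
  induction F using MvPolynomial.induction_on with
  | C a => simp [subst_C]
  | add F G hF hG => simp [subst_add, hF, hG]
  | mul_X F i hF =>
    fin_cases i <;> simp [subst_mul_form, hF, subst_X]

theorem pderiv_subst (A : Matrix (Fin 2) (Fin 2) K) (F : MvPolynomial (Fin 2) K) (i : Fin 2) :
    pderiv i (subst A F) =
      C (A 0 i) * subst A (pderiv 0 F) + C (A 1 i) * subst A (pderiv 1 F) := by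
  induction F using MvPolynomial.induction_on with
  | C a => simp [subst_C]; simp [subst]
  | add F G hF hG => simp only [subst_add, map_add, hF, hG]; ring
  | mul_X F j hF =>
    have h0 : subst A (0 : MvPolynomial (Fin 2) K) = 0 := map_zero _
    have h1 : subst A (1 : MvPolynomial (Fin 2) K) = 1 := map_one _
    have hX : pderiv i (subst A (X j)) = C (A j i) := by
      fin_cases i <;> simp [subst_X]
    simp only [subst_mul_form, pderiv_mul, subst_add, hF, hX, pderiv_X]
    fin_cases j <;> simp [subst_X, h0, h1] <;> ring

theorem jacobian_subst (A : Matrix (Fin 2) (Fin 2) K) (F G : MvPolynomial (Fin 2) K) :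
    jacobian (subst A F) (subst A G) = C A.det * subst A (jacobian F G) := by
  simp only [jacobian, pderiv_subst, subst_sub, subst_mul_form, Matrix.det_fin_two, map_sub,
    map_mul]
  ring

theorem jacobian_C_mul (c : K) (F G : MvPolynomial (Fin 2) K) :
    jacobian F (C c * G) = C c * jacobian F G := by
  simp only [jacobian, pderiv_C_mul]
  ring

theorem pderiv_pderiv_comm (i j : Fin 2) (F : MvPolynomial (Fin 2) K) :
    pderiv i (pderiv j F) = pderiv j (pderiv i F) := by
  induction F using MvPolynomial.induction_on with
  | C a => simp
  | add F G hF hG => simp only [map_add, hF, hG]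
  | mul_X F k hF =>
    simp only [pderiv_mul, map_add, hF, pderiv_X]
    fin_cases i <;> fin_cases j <;> fin_cases k <;> simp

theorem covH_subst (A : Matrix (Fin 2) (Fin 2) K) (F : MvPolynomial (Fin 2) K) :
    covH (subst A F) = C (A.det ^ 2) * subst A (covH F) := by
  simp only [covH, pderiv_subst, map_add, pderiv_C_mul, pderiv_pderiv_comm 1 0 F, subst_sub,
    subst_mul_form, subst_pow, Matrix.det_fin_two, map_sub, map_mul, map_pow]
  ring

theorem covT_subst (A : Matrix (Fin 2) (Fin 2) K) (F : MvPolynomial (Fin 2) K) :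
    covT (subst A F) = C (A.det ^ 3) * subst A (covT F) := by
  rw [covT, covH_subst, jacobian_C_mul, jacobian_subst, ← mul_assoc, ← C_mul, ← pow_succ, covT]

theorem covU_subst (A : Matrix (Fin 2) (Fin 2) K) (F : MvPolynomial (Fin 2) K) :
    covU (subst A F) = C (A.det ^ 4) * subst A (covU F) := by
  rw [covU, covT_subst, jacobian_C_mul, jacobian_subst, ← mul_assoc, ← C_mul, ← pow_succ, covU]

end Covariance

/-! ### Degrees of the covariants -/

section Degree

variable {K : Type*} [CommRing K] {F G : MvPolynomial (Fin 2) K}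

theorem jacobian_isHomogeneous {m n : ℕ} (hF : F.IsHomogeneous m) (hG : G.IsHomogeneous n) :
    (jacobian F G).IsHomogeneous ((m - 1) + (n - 1)) :=
  (hF.pderiv.mul hG.pderiv).sub (hF.pderiv.mul hG.pderiv)

theorem covH_isHomogeneous {n : ℕ} (hF : F.IsHomogeneous n) :
    (covH F).IsHomogeneous (2 * (n - 2)) := by
  have h : ∀ i j, (pderiv i (pderiv j F)).IsHomogeneous (n - 2) := fun i j => hF.pderiv.pderiv
  rw [covH, pow_two, two_mul]
  exact ((h 0 0).mul (h 1 1)).sub ((h 0 1).mul (h 0 1))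

theorem covT_isHomogeneous {n : ℕ} (hn : 3 ≤ n) (hF : F.IsHomogeneous n) :
    (covT F).IsHomogeneous (3 * (n - 2)) := by
  have h := jacobian_isHomogeneous hF (covH_isHomogeneous hF)
  rwa [show n - 1 + (2 * (n - 2) - 1) = 3 * (n - 2) by omega] at h

theorem covU_isHomogeneous {n : ℕ} (hn : 3 ≤ n) (hF : F.IsHomogeneous n) :
    (covU F).IsHomogeneous (4 * (n - 2)) := by
  have h := jacobian_isHomogeneous hF (covT_isHomogeneous hn hF)
  rwa [show n - 1 + (3 * (n - 2) - 1) = 4 * (n - 2) by omega] at h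

end Degree

/-! ### Extension of scalars -/

section Map

variable {K L : Type*} [CommRing K] [CommRing L] (φ : K →+* L)

theorem covH_map (F : MvPolynomial (Fin 2) K) : covH (map φ F) = map φ (covH F) := by
  simp [covH, pderiv_map]

theorem covT_map (F : MvPolynomial (Fin 2) K) : covT (map φ F) = map φ (covT F) := by
  simp [covT, jacobian, covH_map, pderiv_map]

end Map

/-! ### Passage to one variable -/

section Dehomogenization

variable {K : Type*} [CommRing K]

/-- The univariate polynomial `F(t, 1)`. -/
def dehom (F : MvPolynomial (Fin 2) K) : Polynomial K := aeval ![Polynomial.X, 1] F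

theorem homogenize_dehom {F : MvPolynomial (Fin 2) K} {n : ℕ} (hF : F.IsHomogeneous n) :
    (dehom F).homogenize n = F :=
  Polynomial.homogenize_eq_of_isHomogeneous hF rfl

theorem natDegree_dehom_le {F : MvPolynomial (Fin 2) K} {n : ℕ} (hF : F.IsHomogeneous n) :
    (dehom F).natDegree ≤ n := by
  have h := aeval_natDegree_le F hF.totalDegree_le ![(Polynomial.X : Polynomial K), 1] (n := 1)
    (by intro i; fin_cases i <;> simp [Polynomial.natDegree_X_le])
  simpa [dehom] using h

theorem dehom_ne_zero {F : MvPolynomial (Fin 2) K} {n : ℕ} (hF : F.IsHomogeneous n)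
    (h0 : F ≠ 0) : dehom F ≠ 0 := by
  intro h
  exact h0 (by rw [← homogenize_dehom hF, h, Polynomial.homogenize_zero])

end Dehomogenization

/-! ### Counting projective symmetries by zeros of forms -/

section Counting

variable {K : Type*} [Field K]

theorem card_le_of_eval_eq_zero {P : MvPolynomial (Fin 2) K} {d : ℕ} (hP : P.IsHomogeneous d)
    (h0 : P ≠ 0) {ι : Type*} (s : Finset ι) (p : ι → Fin 2 → K) (h1 : ∀ i ∈ s, p i 1 ≠ 0)
    (hinj : ∀ i ∈ s, ∀ j ∈ s, p i 0 * p j 1 = p j 0 * p i 1 → i = j)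
    (hz : ∀ i ∈ s, eval (p i) P = 0) : s.card ≤ d := by
  classical
  have hroot : ∀ i ∈ s, p i 0 / p i 1 ∈ (dehom P).roots.toFinset := by
    intro i hi
    have h := hz i hi
    rw [← homogenize_dehom hP, Polynomial.eval_homogenize (natDegree_dehom_le hP) _ (h1 i hi)] at h
    simpa [dehom_ne_zero hP h0, h1 i hi] using h
  calc s.card ≤ (dehom P).roots.toFinset.card := by
        refine Finset.card_le_card_of_injOn (fun i => p i 0 / p i 1) hroot ?_
        intro i hi j hj hij
        exact hinj i hi j hj (by rwa [div_eq_div_iff (h1 i hi) (h1 j hj)] at hij)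
    _ ≤ (dehom P).roots.card := Multiset.toFinset_card_le _
    _ ≤ d := (Polynomial.card_roots' _).trans (natDegree_dehom_le hP)

/-- The linear form giving the `i`-th coordinate of `A x`. -/
def coordForm (A : Matrix (Fin 2) (Fin 2) K) (i : Fin 2) : MvPolynomial (Fin 2) K :=
  C (A i 0) * X 0 + C (A i 1) * X 1

theorem eval_coordForm (A : Matrix (Fin 2) (Fin 2) K) (i : Fin 2) (p : Fin 2 → K) :
    eval p (coordForm A i) = A.mulVec p i := by
  fin_cases i <;> simp [coordForm]

theorem coordForm_one_ne_zero (A : GL (Fin 2) K) : coordForm (A : Matrix _ _ K) 1 ≠ 0 := by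
  intro h
  have hdet : (A : Matrix (Fin 2) (Fin 2) K).det ≠ 0 := A.det.ne_zero
  have h0 := eval_coordForm (A : Matrix _ _ K) 1 ![1, 0]
  have h1 := eval_coordForm (A : Matrix _ _ K) 1 ![0, 1]
  simp [h] at h0 h1
  simp [Matrix.det_fin_two, ← h0, ← h1] at hdet

/-- The quadratic form vanishing at the points `x` for which `A x` and `B x` are proportional. -/
def coincidenceForm (A B : Matrix (Fin 2) (Fin 2) K) : MvPolynomial (Fin 2) K :=
  coordForm A 0 * coordForm B 1 - coordForm B 0 * coordForm A 1

/-- Up to the factor `det B`, the form at `p` is the determinant of `p` and `M p`. Its vanishing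
makes every vector an eigenvector; testing `e₁`, `e₂` and `e₁ + e₂` forces `M` to be scalar. -/
theorem coincidenceForm_mul_ne_zero [CharZero K] (B : GL (Fin 2) K)
    (M : Matrix (Fin 2) (Fin 2) K)
    (h : coincidenceForm (B : Matrix (Fin 2) (Fin 2) K) (B * M) = 0) :
    ∃ u : K, M = Matrix.scalar (Fin 2) u := by
  have hdet : (B : Matrix (Fin 2) (Fin 2) K).det ≠ 0 := B.det.ne_zero
  have key : ∀ p : Fin 2 → K, (B : Matrix (Fin 2) (Fin 2) K).det *
      (p 0 * M.mulVec p 1 - M.mulVec p 0 * p 1) = 0 := by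
    intro p
    have h2 := congrArg (eval p) h
    simp only [coincidenceForm, map_sub, map_mul, eval_coordForm, map_zero] at h2
    rw [← h2, Matrix.det_fin_two]
    simp [Matrix.mulVec, dotProduct, Fin.sum_univ_two, Matrix.mul_apply]
    ring
  have k1 := key ![1, 0]
  have k2 := key ![0, 1]
  have k3 := key ![1, 1]
  simp [hdet] at k1 k2 k3
  refine ⟨M 0 0, ?_⟩
  ext i j
  fin_cases i <;> fin_cases j <;> simp [k1, k2]
  simp [k1, k2] at k3
  linear_combination k3

theorem coincidenceForm_ne_zero [CharZero K] {A B : GL (Fin 2) K}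
    (h : Matrix.ProjGenLinGroup.mk A ≠ Matrix.ProjGenLinGroup.mk B) :
    coincidenceForm (A : Matrix _ _ K) (B : Matrix _ _ K) ≠ 0 := by
  intro h0
  have hB : (B : Matrix (Fin 2) (Fin 2) K) = A * (A⁻¹ * B : GL (Fin 2) K) := by
    rw [← Units.val_mul, mul_inv_cancel_left]
  rw [hB] at h0
  obtain ⟨u, hu⟩ := coincidenceForm_mul_ne_zero A _ h0
  refine h (Matrix.ProjGenLinGroup.mk_eq_mk_iff'.2 ⟨A⁻¹ * B, ?_, by group⟩)
  exact Matrix.GeneralLinearGroup.mem_center_iff_val_mem_range_scalar.2 ⟨u, hu.symm⟩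

/-- If a nonconstant quotient `S / R` of forms of degree `d` is invariant under the symmetries
of `F`, then `F` has at most `d` projective symmetries. -/
theorem card_projSymmetry_le [CharZero K] {F R S : MvPolynomial (Fin 2) K} {d : ℕ}
    (hR : R.IsHomogeneous d) (hS : S.IsHomogeneous d) (hR0 : R ≠ 0) (hRS : ∀ c : K, S ≠ C c * R)
    (hinv : ∀ A ∈ symmetryGroup F, ∃ u : K,
      subst (A : Matrix _ _ K) R = C u * R ∧ subst (A : Matrix _ _ K) S = C u * S)
    (s : Finset (projSymmetryGroup F)) : s.card ≤ d := by
  classical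
  have hlift : ∀ g : projSymmetryGroup F, ∃ A ∈ symmetryGroup F,
      Matrix.ProjGenLinGroup.mk A = g.1 := fun g => g.2
  choose A hA hAg using hlift
  -- A point `p` with `Q(p) ≠ 0` is general: `R(p) ≠ 0`, and its images under the chosen lifts lie
  -- in the chart `y ≠ 0` and are projectively distinct.
  let Q : MvPolynomial (Fin 2) K := R * ((∏ g ∈ s, coordForm (A g : Matrix _ _ K) 1) *
    ∏ x ∈ s.offDiag, coincidenceForm (A x.1 : Matrix _ _ K) (A x.2 : Matrix _ _ K))
  have hQ : Q ≠ 0 := by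
    refine mul_ne_zero hR0 (mul_ne_zero ?_ ?_)
    · exact Finset.prod_ne_zero_iff.2 fun g _ => coordForm_one_ne_zero _
    · refine Finset.prod_ne_zero_iff.2 fun x hx => coincidenceForm_ne_zero ?_
      rw [hAg, hAg]
      exact fun h => (Finset.mem_offDiag.1 hx).2.2 (Subtype.ext h)
  obtain ⟨p, hp⟩ : ∃ p, eval p Q ≠ 0 := by
    by_contra! h
    exact hQ (funext fun p => by rw [h p, map_zero])
  simp only [Q, map_mul, map_prod, mul_ne_zero_iff, Finset.prod_ne_zero_iff] at hp
  obtain ⟨hpR, hp1, hp2⟩ := hp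
  -- The zeros of this form contain the fibre of `S / R` through `p`, hence all the images of `p`.
  have hP : (C (eval p R) * S - C (eval p S) * R).IsHomogeneous d := (hS.C_mul _).sub (hR.C_mul _)
  refine card_le_of_eval_eq_zero hP ?_ s (fun g => (A g : Matrix _ _ K).mulVec p) ?_ ?_ ?_
  · intro h
    refine hRS (eval p S / eval p R) ?_
    have hC : (C (eval p R) : MvPolynomial (Fin 2) K) ≠ 0 := by simpa using hpR
    apply mul_left_cancel₀ hC
    rw [sub_eq_zero.1 h, ← mul_assoc, ← C_mul, mul_div_cancel₀ _ hpR]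
  · intro g hg
    rw [← eval_coordForm]
    exact hp1 g hg
  · intro g hg g' hg' h
    by_contra hne
    refine hp2 (g, g') (Finset.mem_offDiag.2 ⟨hg, hg', hne⟩) ?_
    simp only [coincidenceForm, map_sub, map_mul, eval_coordForm]
    exact sub_eq_zero.2 h
  · intro g hg
    obtain ⟨u, h1, h2⟩ := hinv (A g) (hA g)
    rw [← eval_subst, subst_sub, subst_mul_form, subst_mul_form, subst_C, subst_C, h1, h2]
    simp only [map_sub, map_mul, eval_C]
    ring

theorem finite_of_finset_card_le {α : Type*} {d : ℕ} (h : ∀ s : Finset α, s.card ≤ d) :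
    Finite α ∧ Nat.card α ≤ d := by
  have hfin : Finite α := by
    by_contra hinf
    rw [not_finite_iff_infinite] at hinf
    obtain ⟨s, hs⟩ := Infinite.exists_subset_card_eq α (d + 1)
    have := h s
    omega
  refine ⟨hfin, ?_⟩
  have := Fintype.ofFinite α
  rw [Nat.card_eq_fintype_card]
  exact h Finset.univ

theorem subst_scalar {F : MvPolynomial (Fin 2) K} {n : ℕ} (hF : F.IsHomogeneous n) (u : K) :
    subst (Matrix.scalar (Fin 2) u) F = C (u ^ n) * F := by
  rw [F.as_sum, Finset.mul_sum]
  refine (map_sum _ _ _).trans (Finset.sum_congr rfl fun m hm => ?_)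
  have hd : m 0 + m 1 = n := by
    have h := hF (mem_support_iff.1 hm)
    simpa [Finsupp.weight_apply, Finsupp.sum_fintype, Fin.sum_univ_two] using h
  rw [aeval_monomial, monomial_eq, Finsupp.prod_fintype _ _ (by simp),
    Finsupp.prod_fintype _ _ (by simp), ← hd]
  simp [Fin.prod_univ_two, algebraMap_eq]
  ring

/-- The kernel of `G_F → Γ_F` consists of scalars `u` with `u ^ n = 1`, so it is finite. -/
theorem finite_symmetryGroup {F : MvPolynomial (Fin 2) K} {n : ℕ} (hF : F.IsHomogeneous n)
    (h0 : F ≠ 0) (hn : n ≠ 0) [Finite (projSymmetryGroup F)] : Finite (symmetryGroup F) := by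
  let f : symmetryGroup F →* projSymmetryGroup F :=
    Matrix.ProjGenLinGroup.mk.subgroupMap (symmetryGroup F)
  have hker : Finite f.ker := by
    have : NeZero n := ⟨hn⟩
    have hroot : ∀ A : f.ker, ∃ u : rootsOfUnity n K,
        (A.1.1 : GL (Fin 2) K) = Matrix.GeneralLinearGroup.scalar (Fin 2) u.1 := by
      rintro ⟨⟨A, hA⟩, hAk⟩
      have h1 : Matrix.ProjGenLinGroup.mk A = 1 := congrArg Subtype.val hAk
      rw [Matrix.ProjGenLinGroup.mk_eq_one, Matrix.GeneralLinearGroup.center_eq_range_scalar] at h1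
      obtain ⟨u, rfl⟩ := h1
      refine ⟨⟨u, ?_⟩, rfl⟩
      have h2 : subst (Matrix.scalar (Fin 2) (u : K)) F = F := hA
      rw [subst_scalar hF] at h2
      have h3 : (C ((u : K) ^ n) - 1) * F = 0 := by rw [sub_mul, h2]; ring
      have h4 : (C ((u : K) ^ n) : MvPolynomial (Fin 2) K) = C 1 := by
        rw [C_1]; exact sub_eq_zero.1 ((mul_eq_zero.1 h3).resolve_right h0)
      rw [mem_rootsOfUnity]
      ext
      simpa using C_injective _ _ h4
    choose g hg using hroot
    refine Finite.of_injective g fun A B h => ?_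
    apply Subtype.ext; apply Subtype.ext
    rw [hg A, hg B, h]
  exact f.finite_iff_finite_ker_range.2 ⟨hker, inferInstance⟩

end Counting

/-! ### The covariants in one variable -/

section DehomCovariants

variable {K : Type*} [CommRing K]

theorem dehom_add (F G : MvPolynomial (Fin 2) K) : dehom (F + G) = dehom F + dehom G :=
  map_add _ _ _

theorem dehom_sub (F G : MvPolynomial (Fin 2) K) : dehom (F - G) = dehom F - dehom G :=
  map_sub _ _ _

theorem dehom_mul (F G : MvPolynomial (Fin 2) K) : dehom (F * G) = dehom F * dehom G :=
  map_mul _ _ _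

theorem dehom_pow (F : MvPolynomial (Fin 2) K) (k : ℕ) : dehom (F ^ k) = dehom F ^ k :=
  map_pow _ _ _

theorem dehom_C (c : K) : dehom (C c) = Polynomial.C c := by
  simp [dehom, Polynomial.algebraMap_eq]

theorem dehom_X_zero : dehom (X 0 : MvPolynomial (Fin 2) K) = Polynomial.X := by
  simp [dehom]

theorem dehom_X_one : dehom (X 1 : MvPolynomial (Fin 2) K) = 1 := by
  simp [dehom]

theorem dehom_pderiv_zero (F : MvPolynomial (Fin 2) K) :
    dehom (pderiv 0 F) = (dehom F).derivative := by
  induction F using MvPolynomial.induction_on with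
  | C a => simp [dehom]
  | add F G hF hG => simp only [map_add, dehom_add, hF, hG]
  | mul_X F i hF =>
    fin_cases i
    · simp [dehom_mul, dehom_add, hF, dehom_X_zero]
      ring
    · simp [dehom_mul, hF, dehom_X_one]

/-- Euler's identity `x F_x + y F_y = n F` at `y = 1`. -/
theorem dehom_pderiv_one {F : MvPolynomial (Fin 2) K} {n : ℕ} (hF : F.IsHomogeneous n) :
    dehom (pderiv 1 F) = (n : Polynomial K) * dehom F - Polynomial.X * (dehom F).derivative := by
  have h := congrArg dehom hF.sum_X_mul_pderiv
  rw [Fin.sum_univ_two, dehom_add, dehom_mul, dehom_mul, dehom_X_zero, dehom_X_one,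
    dehom_pderiv_zero, nsmul_eq_mul, dehom_mul, ← map_natCast (C : K →+* MvPolynomial (Fin 2) K) n,
    dehom_C, map_natCast] at h
  linear_combination h

theorem dehom_jacobian {F G : MvPolynomial (Fin 2) K} {n m : ℕ} (hF : F.IsHomogeneous n)
    (hG : G.IsHomogeneous m) : dehom (jacobian F G) =
      m * (dehom F).derivative * dehom G - n * dehom F * (dehom G).derivative := by
  rw [jacobian, dehom_sub, dehom_mul, dehom_mul, dehom_pderiv_zero, dehom_pderiv_zero,
    dehom_pderiv_one hF, dehom_pderiv_one hG]
  ring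

theorem dehom_covH {F : MvPolynomial (Fin 2) K} {n : ℕ} (hn : 1 ≤ n) (hF : F.IsHomogeneous n) :
    dehom (covH F) = Polynomial.C ((n : K) - 1) * uniHessian n (dehom F) := by
  have h1 := dehom_pderiv_one hF
  have h2 := dehom_pderiv_one (hF.pderiv (i := 1))
  rw [covH, dehom_sub, dehom_mul, dehom_pow, h2, dehom_pderiv_zero, dehom_pderiv_zero,
    dehom_pderiv_zero, h1, uniHessian]
  simp only [Polynomial.derivative_sub, Polynomial.derivative_mul, Polynomial.derivative_natCast,
    Polynomial.derivative_X, Nat.cast_sub hn, Polynomial.C_sub, map_natCast, map_one, Nat.cast_one]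
  ring

end DehomCovariants

/-! ### Recognising monomials; nonconstancy of `T² / H³` -/

section Monomial

variable {K : Type*} [Field K]

theorem EquivalentToMonomial.of_subst {F : MvPolynomial (Fin 2) K} (A : GL (Fin 2) K)
    (h : EquivalentToMonomial (subst (A : Matrix _ _ K) F)) : EquivalentToMonomial F := by
  obtain ⟨c, i, j, B, hB⟩ := h
  exact ⟨c, i, j, A * B, by rw [hB, Units.val_mul, subst_mul]⟩

theorem equivalentToMonomial_of_roots_subset [IsAlgClosed K] [DecidableEq K]
    {F : MvPolynomial (Fin 2) K} {n : ℕ} (hF : F.IsHomogeneous n) (hn : (dehom F).natDegree = n)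
    {a b : K} (hab : a ≠ b) (hroots : (dehom F).roots.toFinset ⊆ {a, b}) :
    EquivalentToMonomial F := by
  set f := dehom F with hf
  have hsub : f.roots.toFinset ⊆ ({a, b} : Finset K) := hroots
  have hprod : f = Polynomial.C f.leadingCoeff *
      ((Polynomial.X - Polynomial.C a) ^ f.roots.count a
        * (Polynomial.X - Polynomial.C b) ^ f.roots.count b) := by
    conv_lhs => rw [(IsAlgClosed.splits f).eq_prod_roots]
    rw [Finset.prod_multiset_map_count, Finset.prod_subset hsub, Finset.prod_pair hab]
    intro x _ hx
    rw [Multiset.count_eq_zero.2 (fun h => hx (Multiset.mem_toFinset.2 h)), pow_zero]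
  have hcount : f.roots.count a + f.roots.count b = n := by
    rw [← hn, ← Polynomial.splits_iff_card_roots.1 (IsAlgClosed.splits f),
      ← Multiset.sum_count_eq_card (s := {a, b})
        (fun x hx => hsub (Multiset.mem_toFinset.2 hx)), Finset.sum_pair hab]
  have hFprod : F = C f.leadingCoeff * ((X 0 - C a * X 1) ^ f.roots.count a
        * (X 0 - C b * X 1) ^ f.roots.count b) := by
    have hlin : ∀ x : K, (X 0 - C x * X 1 : MvPolynomial (Fin 2) K).IsHomogeneous 1 :=
      fun x => (isHomogeneous_X _ _).sub ((isHomogeneous_X _ _).C_mul _)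
    have hhom : (C f.leadingCoeff * ((X 0 - C a * X 1) ^ f.roots.count a
        * (X 0 - C b * X 1) ^ f.roots.count b) : MvPolynomial (Fin 2) K).IsHomogeneous n := by
      have := ((hlin a).pow (f.roots.count a)).mul ((hlin b).pow (f.roots.count b))
      rw [one_mul, one_mul, hcount] at this
      exact this.C_mul _
    rw [← homogenize_dehom hF, ← homogenize_dehom hhom, ← hf]
    congr 1
    simp only [dehom_mul, dehom_pow, dehom_sub, dehom_C, dehom_X_zero, dehom_X_one, mul_one]
    exact hprod
  -- The linear factors `x - a y` and `x - b y` become the new coordinates.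
  let M : Matrix (Fin 2) (Fin 2) K := !![1, -a; 1, -b]
  have hM : M.det ≠ 0 := by
    simpa [M, Matrix.det_fin_two, neg_add_eq_sub, sub_eq_zero] using hab
  let A : GL (Fin 2) K := Matrix.GeneralLinearGroup.mkOfDetNeZero M hM
  refine ⟨f.leadingCoeff, f.roots.count a, f.roots.count b, A⁻¹, ?_⟩
  have hsubst : F = subst (A : Matrix _ _ K)
      (C f.leadingCoeff * X 0 ^ f.roots.count a * X 1 ^ f.roots.count b) := by
    have hA : (A : Matrix (Fin 2) (Fin 2) K) = M := rfl
    conv_lhs => rw [hFprod]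
    simp [subst_mul_form, subst_pow, subst_C, subst_X, hA, M, sub_eq_add_neg, mul_assoc]
  rw [hsubst, ← subst_mul, ← Units.val_mul, mul_inv_cancel, Units.val_one, subst_one]

theorem equivalentToMonomial_of_card_roots_le_two [IsAlgClosed K] [DecidableEq K]
    {F : MvPolynomial (Fin 2) K} {n : ℕ} (hF : F.IsHomogeneous n) (hn : (dehom F).natDegree = n)
    (h : (dehom F).roots.toFinset.card ≤ 2) : EquivalentToMonomial F := by
  have : Infinite K := IsAlgClosed.instInfinite
  obtain ⟨s, hs, hcard⟩ := Infinite.exists_superset_card_eq _ 2 h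
  obtain ⟨a, b, hab, rfl⟩ := Finset.card_eq_two.1 hcard
  exact equivalentToMonomial_of_roots_subset hF hn hab hs

theorem coeff_dehom {F : MvPolynomial (Fin 2) K} {n : ℕ} (hF : F.IsHomogeneous n) :
    (dehom F).coeff n = eval ![1, 0] F := by
  conv_rhs => rw [← homogenize_dehom hF]
  rw [Polynomial.homogenize, eval_sum, Finset.sum_eq_single (n, 0)]
  · rw [eval_monomial, Finsupp.prod_fintype _ _ (by simp)]
    simp
  · rintro ⟨k, l⟩ hkl hne
    have hl : l ≠ 0 := by
      rintro rfl
      simp_all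
    rw [eval_monomial, Finsupp.prod_fintype _ _ (by simp)]
    simp [hl]
  · simp

theorem exists_natDegree_dehom_subst [CharZero K] {F : MvPolynomial (Fin 2) K} {n : ℕ}
    (hF : F.IsHomogeneous n) (h0 : F ≠ 0) :
    ∃ A : GL (Fin 2) K, (subst (A : Matrix _ _ K) F).IsHomogeneous n ∧
      (dehom (subst (A : Matrix _ _ K) F)).natDegree = n := by
  -- The matrix `M` below sends `(1, 0)` to `p`, so the coefficient of `t ^ n` becomes `F(p) ≠ 0`.
  -- The factor `X 0` ensures `p 0 ≠ 0`, which makes `M` invertible.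
  obtain ⟨p, hp⟩ : ∃ p, eval p (F * X 0) ≠ 0 := by
    by_contra! h
    exact mul_ne_zero h0 (X_ne_zero 0) (funext fun p => by rw [h p, map_zero])
  rw [map_mul, eval_X] at hp
  let M : Matrix (Fin 2) (Fin 2) K := !![p 0, 0; p 1, 1]
  have hM : M.det ≠ 0 := by
    simpa [M, Matrix.det_fin_two] using right_ne_zero_of_mul hp
  have hhom : (subst M F).IsHomogeneous n := by
    have h := hF.aeval (fun i => ∑ j, C (M i j) * (X j : MvPolynomial (Fin 2) K)) (n := 1)
      (fun i => IsHomogeneous.sum _ _ _ fun j _ => (isHomogeneous_X _ _).C_mul _)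
    rwa [one_mul] at h
  refine ⟨Matrix.GeneralLinearGroup.mkOfDetNeZero M hM, hhom, ?_⟩
  refine le_antisymm (natDegree_dehom_le hhom) (Polynomial.le_natDegree_of_ne_zero ?_)
  change (dehom (subst M F)).coeff n ≠ 0
  rw [coeff_dehom hhom, eval_subst]
  convert left_ne_zero_of_mul hp using 2
  have : M.mulVec ![1, 0] = p := by
    ext i
    fin_cases i <;> simp [M]
  rw [this]

variable [CharZero K] [IsAlgClosed K]

theorem three_le_of_not_equivalentToMonomial {F : MvPolynomial (Fin 2) K} {n : ℕ}
    (hF : F.IsHomogeneous n) (h0 : F ≠ 0) (hmon : ¬ EquivalentToMonomial F) : 3 ≤ n := by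
  classical
  by_contra! hn
  obtain ⟨A, hA, hdeg⟩ := exists_natDegree_dehom_subst hF h0
  refine hmon (.of_subst A (equivalentToMonomial_of_card_roots_le_two hA hdeg ?_))
  have h1 := Multiset.toFinset_card_le (dehom (subst (A : Matrix _ _ K) F)).roots
  have h2 := Polynomial.card_roots' (dehom (subst (A : Matrix _ _ K) F))
  omega

theorem covT_sq_ne {F : MvPolynomial (Fin 2) K} {n : ℕ}
    (hF : F.IsHomogeneous n) (h0 : F ≠ 0) (hmon : ¬ EquivalentToMonomial F) :
    covH F ≠ 0 ∧ ∀ c : K, covT F ^ 2 ≠ C c * covH F ^ 3 := by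
  classical
  have hn := three_le_of_not_equivalentToMonomial hF h0 hmon
  obtain ⟨A, hA, hdeg⟩ := exists_natDegree_dehom_subst hF h0
  set f := dehom (subst (A : Matrix _ _ K) F) with hf
  have hroots : 2 < f.roots.toFinset.card := by
    by_contra! h
    exact hmon (.of_subst A (equivalentToMonomial_of_card_roots_le_two hA hdeg h))
  -- A root of multiplicity `n` would be the only root.
  have hmult : ∀ a, f.rootMultiplicity a < n := by
    intro a
    by_contra! h
    have h1 : f.roots.count a = Multiset.card f.roots :=
      le_antisymm (Multiset.count_le_card _ _)
        ((Polynomial.card_roots' f).trans (by rwa [hdeg, Polynomial.count_roots]))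
    have h2 : f.roots.toFinset ⊆ {a} := fun x hx =>
      Finset.mem_singleton.2 (Multiset.count_eq_card.1 h1 x (Multiset.mem_toFinset.1 hx)).symm
    have h3 := Finset.card_le_card h2
    rw [Finset.card_singleton] at h3
    omega
  have hn1 : Polynomial.C ((n : K) - 1) ≠ 0 := by
    rw [Ne, Polynomial.C_eq_zero, sub_eq_zero]
    exact_mod_cast (by omega : n ≠ 1)
  have hH := dehom_covH (by omega) hA
  have hT := dehom_jacobian hA (covH_isHomogeneous hA)
  rw [← covT, hH, ← hf] at hT
  have hne : ∀ c : K, covT F ^ 2 ≠ C c * covH F ^ 3 := by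
    intro c hc
    have hc' : covT (subst (A : Matrix _ _ K) F) ^ 2
        = C c * covH (subst (A : Matrix _ _ K) F) ^ 3 := by
      have h := congrArg (subst (A : Matrix _ _ K)) hc
      rw [subst_mul_form, subst_pow, subst_pow, subst_C] at h
      rw [covT_subst, covH_subst, mul_pow, h]
      simp only [map_pow]
      ring
    have h := congrArg dehom hc'
    rw [dehom_mul, dehom_pow, dehom_pow, dehom_C, hH, hT, ← hf, Polynomial.derivative_C_mul] at h
    -- Since `H` dehomogenizes to `(n - 1)` times `uniHessian`, `T²` carries `(n - 1)²` and `H³`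
    -- carries `(n - 1)³`; the surplus factor goes into the constant.
    refine hroots.not_ge (card_roots_le_two_of_jacobian_sq (c := c * (n - 1)) (by omega) hdeg
      hmult ?_)
    apply mul_left_cancel₀ (pow_ne_zero 2 hn1)
    rw [Polynomial.C_mul]
    linear_combination h
  -- If `H = 0` then `T = 0`, which is the excluded relation with `c = 0`.
  refine ⟨fun h => hne 0 ?_, hne⟩
  rw [covT, h, jacobian]
  simp

end Monomial

/-! ### The two bounds and the main theorem -/

theorem nonsingular_and_projIndex_le {K : Type*} [Field K] [CharZero K]
    {F : MvPolynomial (Fin 2) K} {n : ℕ} (hn : 3 ≤ n) (hF : F.IsHomogeneous n) (h0 : F ≠ 0)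
    (hH : covH F ≠ 0) (hT : ∀ c : K, covT F ^ 2 ≠ C c * covH F ^ 3) :
    Nonsingular F ∧
      (MaximalDiscreteClass F → (projIndex F : ℤ) ≤ 6 * (n : ℤ) - 12) ∧
      (¬ MaximalDiscreteClass F → (projIndex F : ℤ) ≤ 4 * (n : ℤ) - 8) := by
  -- Take `u = (det A)⁻¹`, from the covariance formulas with `F(A x) = F(x)`.
  have hcov : ∀ A ∈ symmetryGroup F, ∃ u : K,
      subst (A : Matrix _ _ K) (covH F) = C (u ^ 2) * covH F ∧
      subst (A : Matrix _ _ K) (covT F) = C (u ^ 3) * covT F ∧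
      subst (A : Matrix _ _ K) (covU F) = C (u ^ 4) * covU F := by
    intro A hA
    have hA' : subst (A : Matrix _ _ K) F = F := hA
    have hdet : (A : Matrix (Fin 2) (Fin 2) K).det ≠ 0 := A.det.ne_zero
    have hinv : ∀ (k : ℕ) (G G' : MvPolynomial (Fin 2) K),
        G = C ((A : Matrix (Fin 2) (Fin 2) K).det ^ k) * G' →
        G' = C ((A : Matrix (Fin 2) (Fin 2) K).det⁻¹ ^ k) * G := by
      rintro k _ G' rfl
      rw [← mul_assoc, ← C_mul, ← mul_pow, inv_mul_cancel₀ hdet, one_pow, C_1, one_mul]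
    refine ⟨(A : Matrix (Fin 2) (Fin 2) K).det⁻¹, hinv _ _ _ ?_, hinv _ _ _ ?_, hinv _ _ _ ?_⟩
    · rw [← covH_subst, hA']
    · rw [← covT_subst, hA']
    · rw [← covU_subst, hA']
  have h6 := finite_of_finset_card_le (card_projSymmetry_le (F := F) (d := 6 * (n - 2))
    (R := covH F ^ 3) (S := covT F ^ 2)
    (by simpa only [show 2 * (n - 2) * 3 = 6 * (n - 2) by omega] using
      (covH_isHomogeneous hF).pow 3)
    (by simpa only [show 3 * (n - 2) * 2 = 6 * (n - 2) by omega] using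
      (covT_isHomogeneous hn hF).pow 2)
    (pow_ne_zero 3 hH) hT (by
      intro A hA
      obtain ⟨u, h1, h2, -⟩ := hcov A hA
      refine ⟨u ^ 6, ?_, ?_⟩
      · rw [subst_pow, h1, mul_pow, ← C_pow, ← pow_mul]
      · rw [subst_pow, h2, mul_pow, ← C_pow, ← pow_mul]))
  have hfin := h6.1
  refine ⟨finite_symmetryGroup hF h0 (by omega), fun _ => ?_, fun hU => ?_⟩
  · have h : projIndex F ≤ 6 * (n - 2) := h6.2
    omega
  · have h : projIndex F ≤ 4 * (n - 2) := (finite_of_finset_card_le (card_projSymmetry_le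
      (F := F) (R := covH F ^ 2) (S := covU F)
      (by simpa only [show 2 * (n - 2) * 2 = 4 * (n - 2) by omega] using
        (covH_isHomogeneous hF).pow 2)
      (covU_isHomogeneous hn hF) (pow_ne_zero 2 hH) (fun c hc => hU ⟨c, hc⟩) (by
        intro A hA
        obtain ⟨u, h1, -, h3⟩ := hcov A hA
        refine ⟨u ^ 4, ?_, h3⟩
        rw [subst_pow, h1, mul_pow, ← C_pow, ← pow_mul]))).2
    omega

end BinaryForm

end

theorem mainTheorem10 :
    -- complex binary forms
    (∀ (n : ℕ) (F : MvPolynomial (Fin 2) ℂ), F.IsHomogeneous n → F ≠ 0 →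
      ¬ BinaryForm.EquivalentToMonomial F →
        BinaryForm.Nonsingular F ∧
        (BinaryForm.MaximalDiscreteClass F →
          (BinaryForm.projIndex F : ℤ) ≤ 6 * (n : ℤ) - 12) ∧
        (¬ BinaryForm.MaximalDiscreteClass F →
          (BinaryForm.projIndex F : ℤ) ≤ 4 * (n : ℤ) - 8)) ∧
    -- real binary forms, with real symmetries
    (∀ (n : ℕ) (F : MvPolynomial (Fin 2) ℝ), F.IsHomogeneous n → F ≠ 0 →
      ¬ BinaryForm.EquivalentToMonomial (MvPolynomial.map (algebraMap ℝ ℂ) F) →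
        BinaryForm.Nonsingular F ∧
        (BinaryForm.MaximalDiscreteClass F →
          (BinaryForm.projIndex F : ℤ) ≤ 6 * (n : ℤ) - 12) ∧
        (¬ BinaryForm.MaximalDiscreteClass F →
          (BinaryForm.projIndex F : ℤ) ≤ 4 * (n : ℤ) - 8)) := by
  refine ⟨fun n F hF h0 hmon => ?_, fun n F hF h0 hmon => ?_⟩
  · obtain ⟨hH, hT⟩ := BinaryForm.covT_sq_ne hF h0 hmon
    exact BinaryForm.nonsingular_and_projIndex_le
      (BinaryForm.three_le_of_not_equivalentToMonomial hF h0 hmon) hF h0 hH hT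
  -- Only the nonvanishing of `H` and nonconstancy of `T² / H³` are taken from `ℂ`, as a relation
  -- over `ℝ` persists there; the symmetries are counted over `ℝ`.
  · have hF' := hF.map (algebraMap ℝ ℂ)
    have h0' : MvPolynomial.map (algebraMap ℝ ℂ) F ≠ 0 := by
      rwa [Ne, map_eq_zero_iff _ (MvPolynomial.map_injective _ (algebraMap ℝ ℂ).injective)]
    obtain ⟨hH, hT⟩ := BinaryForm.covT_sq_ne hF' h0' hmon
    refine BinaryForm.nonsingular_and_projIndex_le
      (BinaryForm.three_le_of_not_equivalentToMonomial hF' h0' hmon) hF h0 ?_ ?_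
    · intro h
      exact hH (by rw [BinaryForm.covH_map, h, map_zero])
    · intro c hc
      refine hT (algebraMap ℝ ℂ c) ?_
      rw [BinaryForm.covT_map, BinaryForm.covH_map, ← map_pow, hc, map_mul, map_pow,
        MvPolynomial.map_C]
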